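/- Let $H$ be a separable (real or complex) Hilbert space and $A:D(A)\subset H\to H$ a positive self-adjoint operator whose inverse exists and is compact. Let $T>0$, $0<\rho<1$ and $\mu>0$. For $w:[0,T]\to H$ the Caputo derivative of order $\rho$ is understood, as usual for functions that need not be absolutely continuous, as $$D_t^\rho w(t)=\frac{1}{\Gamma(1-\rho)}\,\frac{d}{dt}\int_0^t\frac{w(s)-w(0)}{(t-s)^{\rho}}\,ds,\qquad 0<t\le T,$$ provided the right-hand side exists (with a one-sided derivative at $t=T$); when $w$ is absolutely continuous and $\int_0^t (t-\xi)^{-\rho}w'(\xi)\,d\xi$ is continuous on $(0,T]$, this is $\frac1{\Gamma(1-\rho)}\int_0^t (t-\xi)^{-\rho}w'(\xi)\,d\xi$. Suppose that $\sigma\in C[0,T]$ is real-valued with $\sigma(t)\ge m_\sigma$ on $[0,T]$ for a constant $m_\sigma>0$, that $r\in C[0,T]$ is scalar-valued, that $g\in H$, and that $\phi\in D(A)$. Then the forward problem $$D_t^\rho[u(t)+\mu Au(t)]+\sigma(t)Au(t)=r(t)g,\quad t\in(0,T],\qquad u(0)=\phi,$$ has a unique solution on $[0,T]$. Here a solution is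 a function $u\in C([0,T];H)$ with $u(t)\in D(A)$ for all $t\in[0,T]$ and $Au,\ D_t^\rho u,\ D_t^\rho (Au)\in C((0,T];H)$ that satisfies the equation and the initial condition. -/

import Mathlib

open Set MeasureTheory

noncomputable section

/-- `A⁻¹` exists as an everywhere defined operator on `H`, and it is compact. -/
def HasCompactInverse {𝕜 H : Type*} [RCLike 𝕜] [NormedAddCommGroup H] [InnerProductSpace 𝕜 H]
    (A : H →ₗ.[𝕜] H) : Prop :=
  ∃ K : H →L[𝕜] H, IsCompactOperator K ∧
    (∀ y : H, ∃ h : K y ∈ A.domain, A ⟨K y, h⟩ = y) ∧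
    (∀ x : A.domain, K (A x) = (x : H))

/-- `A` is positive: `(A x, x) ≥ 0` on the domain of `A`. -/
def IsPositiveOp {𝕜 H : Type*} [RCLike 𝕜] [NormedAddCommGroup H] [InnerProductSpace 𝕜 H]
    (A : H →ₗ.[𝕜] H) : Prop :=
  ∀ x : A.domain, 0 ≤ RCLike.re (inner 𝕜 (A x) (x : H))

open Classical in
/-- The value `A x` of a partially defined operator, with the dummy value `0` off the domain
(only ever used together with `x ∈ A.domain`). -/
def opVal {𝕜 H : Type*} [RCLike 𝕜] [NormedAddCommGroup H] [InnerProductSpace 𝕜 H]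
    (A : H →ₗ.[𝕜] H) (x : H) : H :=
  if h : x ∈ A.domain then A ⟨x, h⟩ else 0

/-- The fractional integral `I^{1-ρ} (w - w(0))` at time `t`, that is
`Γ(1-ρ)⁻¹ ∫₀ᵗ (t-s)^{-ρ} (w(s) - w(0)) ds`. -/
def caputoIntegral {H : Type*} [NormedAddCommGroup H] [NormedSpace ℝ H]
    (ρ : ℝ) (w : ℝ → H) (t : ℝ) : H :=
  (Real.Gamma (1 - ρ))⁻¹ • ∫ s in (0 : ℝ)..t, (t - s) ^ (-ρ) • (w s - w 0)

/-- On `(0,T]` the Caputo derivative `D_t^ρ w` exists and equals `d`, for functions `w` on `[0,T]`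
that need not be absolutely continuous: `D_t^ρ w = d/dt I^{1-ρ} (w - w(0))`.
For absolutely continuous `w` with continuous `d` this is
`Γ(1-ρ)⁻¹ ∫₀ᵗ (t-ξ)^{-ρ} w'(ξ) dξ = d(t)`. The defining integral is required to converge, and
the derivative is one-sided at the end point `T`. -/
def HasCaputoDerivOn {H : Type*} [NormedAddCommGroup H] [NormedSpace ℝ H]
    (ρ T : ℝ) (w d : ℝ → H) : Prop :=
  (∀ t ∈ Ioc 0 T,
    IntervalIntegrable (fun s => (t - s) ^ (-ρ) • (w s - w 0)) volume 0 t) ∧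
  (∀ t ∈ Ioc 0 T, HasDerivWithinAt (caputoIntegral ρ w) (d t) (Icc 0 T) t)

/-- `u` is a solution on `[0,T]` of
`D_t^ρ [u + μ A u] + σ(t) A u = r(t) g` for `0 < t ≤ T`, `u(0) = φ`:
`u ∈ C([0,T];H)`, and `A u`, `D_t^ρ u`, `D_t^ρ (A u)` belong to `C((0,T];H)`. -/
structure IsForwardSolution {𝕜 H : Type*} [RCLike 𝕜] [NormedAddCommGroup H]
    [InnerProductSpace 𝕜 H] [NormedSpace ℝ H]
    (A : H →ₗ.[𝕜] H) (ρ μ T : ℝ) (σ : ℝ → ℝ) (r : ℝ → 𝕜) (g φ : H) (u : ℝ → H) : Prop where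
  continuousOn : ContinuousOn u (Icc 0 T)
  mem_domain : ∀ t ∈ Icc 0 T, u t ∈ A.domain
  continuousOn_op : ContinuousOn (fun t => opVal A (u t)) (Ioc 0 T)
  caputo : ∃ d : ℝ → H, ContinuousOn d (Ioc 0 T) ∧ HasCaputoDerivOn ρ T u d
  caputo_op : ∃ d : ℝ → H, ContinuousOn d (Ioc 0 T) ∧
    HasCaputoDerivOn ρ T (fun t => opVal A (u t)) d
  equation : ∃ d : ℝ → H, HasCaputoDerivOn ρ T (fun t => u t + μ • opVal A (u t)) d ∧
    ∀ t ∈ Ioc 0 T, d t + σ t • opVal A (u t) = r t • g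
  initial : u 0 = φ

end

/-! Let `K = A⁻¹`, a bounded operator. Positivity of `A` gives `Re (K x, x) ≥ 0`, so `K + μ` is
coercive and has a bounded inverse `S`. In terms of `y = A u` the equation becomes `D^ρ y = S (r g)
- σ S y`, a linear fractional equation with bounded coefficients. The identity `I^{1-ρ} I^ρ = I^1`
(`fracInt_fracInt`) links it to the Volterra equation `y = A φ + I^ρ (S (r g) - σ S y)`, whose
right-hand side is a contraction in the norm `sup e^{-ct} ‖y t‖` for large `c` (`norm_fracInt_le`).
Existence follows with `u = K y`.

Uniqueness cannot be argued on `A u`, which is only known to be continuous away from `0`. Applying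
`K S` to the equation gives instead `D^ρ u = K S (r g) - σ S u`, a Volterra equation for `u` itself,
which is continuous up to `0`. -/

noncomputable section

/-- The Riemann–Liouville fractional integral of order `a`, based at `0`. -/
def fracInt {E : Type*} [NormedAddCommGroup E] [NormedSpace ℝ E] (a : ℝ) (f : ℝ → E) (t : ℝ) : E :=
  (Real.Gamma a)⁻¹ • ∫ s in (0 : ℝ)..t, (t - s) ^ (a - 1) • f s

/-! ### Riemann–Liouville fractional integrals -/

section FracInt

variable {E : Type*} [NormedAddCommGroup E] [NormedSpace ℝ E]

theorem intervalIntegrable_sub_rpow {a : ℝ} (ha : 0 < a) (t : ℝ) :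
    IntervalIntegrable (fun s : ℝ => (t - s) ^ (a - 1)) volume 0 t := by
  have h := (intervalIntegral.intervalIntegrable_rpow' (a := t) (b := 0)
    (show -1 < a - 1 by linarith)).comp_sub_left t
  simpa using h

theorem intervalIntegrable_sub_rpow_smul {a : ℝ} (ha : 0 < a) {t : ℝ} (ht : 0 ≤ t) {f : ℝ → E}
    (hf : ContinuousOn f (Icc 0 t)) :
    IntervalIntegrable (fun s : ℝ => (t - s) ^ (a - 1) • f s) volume 0 t :=
  (intervalIntegrable_sub_rpow ha t).smul_continuousOn (by rwa [uIcc_of_le ht])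

theorem fracInt_congr {a t : ℝ} (ht : 0 ≤ t) {f g : ℝ → E} (h : EqOn f g (Icc 0 t)) :
    fracInt a f t = fracInt a g t := by
  unfold fracInt
  congr 1
  refine intervalIntegral.integral_congr fun s hs => ?_
  rw [uIcc_of_le ht] at hs
  simp only [h hs]

theorem fracInt_sub {a : ℝ} (ha : 0 < a) {t : ℝ} (ht : 0 ≤ t) {f g : ℝ → E}
    (hf : ContinuousOn f (Icc 0 t)) (hg : ContinuousOn g (Icc 0 t)) :
    fracInt a (fun s => f s - g s) t = fracInt a f t - fracInt a g t := by
  unfold fracInt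
  rw [← smul_sub, ← intervalIntegral.integral_sub (intervalIntegrable_sub_rpow_smul ha ht hf)
    (intervalIntegrable_sub_rpow_smul ha ht hg)]
  simp only [smul_sub]

@[simp] theorem fracInt_zero_right (a : ℝ) (f : ℝ → E) : fracInt a f 0 = 0 := by
  simp [fracInt]

/-- The substitution `s = t x` fixes the interval and the singular kernel, leaving `t` only in `t ^
a` and `f (t x)`; continuity in `t` then follows by dominated convergence. -/
theorem fracInt_eq_scaled {a : ℝ} (ha : 0 < a) {t : ℝ} (ht : 0 ≤ t) (f : ℝ → E) :
    fracInt a f t =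
      (Real.Gamma a)⁻¹ • t ^ a • ∫ x in (0 : ℝ)..1, (1 - x) ^ (a - 1) • f (t * x) := by
  rcases ht.eq_or_lt with rfl | ht0
  · simp [Real.zero_rpow ha.ne']
  unfold fracInt
  congr 1
  have h := intervalIntegral.smul_integral_comp_mul_left (a := 0) (b := 1)
    (fun s : ℝ => (t - s) ^ (a - 1) • f s) t
  simp only [mul_zero, mul_one] at h
  rw [← h]
  have h1 : t ^ a = t * t ^ (a - 1) := by
    rw [Real.rpow_sub_one ht0.ne']; field_simp
  rw [h1, mul_smul, ← intervalIntegral.integral_smul (t ^ (a - 1))]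
  congr 1
  refine intervalIntegral.integral_congr fun x hx => ?_
  rw [uIcc_of_le zero_le_one] at hx
  have : t - t * x = t * (1 - x) := by ring
  simp only [this, Real.mul_rpow ht (sub_nonneg.2 hx.2), mul_smul]

theorem continuousOn_fracInt {a : ℝ} (ha : 0 < a) {T : ℝ} {f : ℝ → E}
    (hf : ContinuousOn f (Icc 0 T)) : ContinuousOn (fracInt a f) (Icc 0 T) := by
  obtain ⟨M, hM⟩ := isCompact_Icc.exists_bound_of_continuousOn hf
  have hmul : ∀ t ∈ Icc 0 T, ∀ x ∈ Icc (0 : ℝ) 1, t * x ∈ Icc 0 T := fun t ht x hx =>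
    ⟨mul_nonneg ht.1 hx.1, (mul_le_of_le_one_right ht.1 hx.2).trans ht.2⟩
  have hI : IntervalIntegrable (fun s : ℝ => (1 - s) ^ (a - 1)) volume 0 1 :=
    intervalIntegrable_sub_rpow ha 1
  have key : ContinuousOn (fun t => ∫ x in (0 : ℝ)..1, (1 - x) ^ (a - 1) • f (t * x))
      (Icc 0 T) := by
    intro t₀ ht₀
    refine intervalIntegral.continuousWithinAt_of_dominated_interval
      (bound := fun x => ‖(1 - x) ^ (a - 1)‖ * M) ?_ ?_ (hI.norm.mul_const M) ?_
    · filter_upwards [self_mem_nhdsWithin] with t ht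
      refine (IntervalIntegrable.def' (hI.smul_continuousOn ?_)).aestronglyMeasurable
      rw [uIcc_of_le zero_le_one]
      exact hf.comp (by fun_prop) fun x hx => hmul t ht x hx
    · filter_upwards [self_mem_nhdsWithin] with t ht
      refine Filter.Eventually.of_forall fun x hx => ?_
      rw [uIoc_of_le zero_le_one] at hx
      rw [norm_smul]
      gcongr
      exact hM _ (hmul t ht x ⟨hx.1.le, hx.2⟩)
    · refine Filter.Eventually.of_forall fun x hx => ?_
      rw [uIoc_of_le zero_le_one] at hx
      have : ContinuousOn (fun t => f (t * x)) (Icc 0 T) :=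
        hf.comp (by fun_prop) fun t ht => hmul t ht x ⟨hx.1.le, hx.2⟩
      exact (this t₀ ht₀).const_smul _
  have : ContinuousOn (fun t => (Real.Gamma a)⁻¹ • t ^ a •
      ∫ x in (0 : ℝ)..1, (1 - x) ^ (a - 1) • f (t * x)) (Icc 0 T) :=
    (((Real.continuous_rpow_const ha.le).continuousOn).smul key).const_smul _
  exact this.congr fun t ht => fracInt_eq_scaled ha ht.1 f

/-- This is the beta integral `B(a, 1-a)`. The exponents sum to `-1`, so its value does not depend
on `r` and `t`. -/
theorem integral_rpow_mul_rpow_eq_Gamma {a : ℝ} (ha : 0 < a) (ha1 : a < 1) {r t : ℝ}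
    (hrt : r < t) :
    ∫ s in r..t, (t - s) ^ (1 - a - 1) * (s - r) ^ (a - 1) =
      Real.Gamma (1 - a) * Real.Gamma a := by
  have h0 : ∫ x in (0 : ℝ)..(t - r), ((t - r) - x) ^ (1 - a - 1) * x ^ (a - 1) =
      Real.Gamma (1 - a) * Real.Gamma a := by
    have h := Complex.betaIntegral_scaled (a : ℂ) ((1 - a : ℝ) : ℂ) (sub_pos.2 hrt)
    have hG := Complex.Gamma_mul_Gamma_eq_betaIntegral (s := (a : ℂ)) (t := ((1 - a : ℝ) : ℂ))
      (by simpa) (by simpa using ha1)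
    have h1 : (a : ℂ) + ((1 - a : ℝ) : ℂ) = 1 := by push_cast; ring
    rw [h1] at h hG
    rw [Complex.Gamma_one, one_mul] at hG
    rw [← hG, sub_self, Complex.cpow_zero, one_mul, Complex.Gamma_ofReal,
      Complex.Gamma_ofReal] at h
    apply Complex.ofReal_injective
    rw [← intervalIntegral.integral_ofReal, Complex.ofReal_mul, mul_comm, ← h]
    refine intervalIntegral.integral_congr fun x hx => ?_
    rw [uIcc_of_le (sub_nonneg.2 hrt.le)] at hx
    rw [Complex.ofReal_mul, Complex.ofReal_cpow (sub_nonneg.2 hx.2), Complex.ofReal_cpow hx.1,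
      mul_comm]
    push_cast
    ring_nf
  rw [← h0]
  have h := intervalIntegral.integral_comp_sub_right (a := r) (b := t)
    (fun x => ((t - r) - x) ^ (1 - a - 1) * x ^ (a - 1)) r
  rw [sub_self] at h
  rw [← h]
  refine intervalIntegral.integral_congr fun s _ => ?_
  congr 2
  ring

theorem integrable_indicator_rpow {a : ℝ} (ha : 0 < a) (t : ℝ) :
    Integrable ((Ioo 0 t).indicator fun x : ℝ => x ^ (a - 1)) := by
  rw [integrable_indicator_iff measurableSet_Ioo]
  rcases le_total 0 t with ht | ht
  · exact ((intervalIntegrable_iff_integrableOn_Ioc_of_le ht).1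
      (intervalIntegral.intervalIntegrable_rpow' (by linarith))).mono_set Ioo_subset_Ioc_self
  · simp [Ioo_eq_empty ht.not_gt]

/-- `I^{1-a} I^a = I^1`. -/
theorem fracInt_fracInt {a : ℝ} (ha : 0 < a) (ha1 : a < 1) {t : ℝ} (ht : 0 ≤ t) {f : ℝ → E}
    [CompleteSpace E] (hf : ContinuousOn f (Icc 0 t)) :
    fracInt (1 - a) (fracInt a f) t = ∫ s in (0 : ℝ)..t, f s := by
  obtain ⟨M, hM⟩ := isCompact_Icc.exists_bound_of_continuousOn hf
  have hM0 : 0 ≤ M := (norm_nonneg _).trans (hM 0 ⟨le_rfl, ht⟩)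
  -- Cutting the kernels and `f` off outside `(0,t)` turns the double integral over the triangle `0
  -- < r < s < t` into one over the plane, where Fubini applies because the product of kernels is a
  -- convolution integrand.
  let k : ℝ → ℝ → ℝ := fun b => (Ioo 0 t).indicator fun x : ℝ => x ^ (b - 1)
  let F : ℝ → E := (Ioo 0 t).indicator f
  have hk : ∀ b, 0 < b → Integrable (k b) := fun b hb => integrable_indicator_rpow hb t
  have hF : Integrable F := by
    rw [integrable_indicator_iff measurableSet_Ioo]
    exact (hf.integrableOn_Icc).mono_set Ioo_subset_Icc_self
  have hFM : ∀ r, ‖F r‖ ≤ M := by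
    intro r
    by_cases hr : r ∈ Ioo 0 t
    · simp only [F, indicator_of_mem hr]; exact hM r ⟨hr.1.le, hr.2.le⟩
    · simp only [F, indicator_of_notMem hr, norm_zero]; exact hM0
  have hint : Integrable (Function.uncurry fun r s => (k (1 - a) (t - s) * k a (s - r)) • F r)
      (volume.prod volume) := by
    have h1 : Integrable (fun p : ℝ × ℝ => k (1 - a) (t - p.2) * k a (-(p.1 - p.2)))
        (volume.prod volume) :=
      Integrable.convolution_integrand (ContinuousLinearMap.mul ℝ ℝ)
        (f := fun s => k (1 - a) (t - s)) (g := fun x => k a (-x))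
        ((hk (1 - a) (by linarith)).comp_sub_left t) ((hk a ha).comp_neg)
    have h2 : (Function.uncurry fun r s => (k (1 - a) (t - s) * k a (s - r)) • F r) =
        fun p : ℝ × ℝ => (k (1 - a) (t - p.2) * k a (-(p.1 - p.2))) • F p.1 := by
      ext ⟨r, s⟩
      simp [Function.uncurry]
    rw [h2]
    refine (h1.norm.mul_const M).mono' (h1.aestronglyMeasurable.smul
      hF.aestronglyMeasurable.comp_fst) (Filter.Eventually.of_forall fun p => ?_)
    rw [norm_smul]
    gcongr
    exact hFM _
  have hswap := integral_integral_swap hint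
  have hleft : ∀ r, ∫ s, (k (1 - a) (t - s) * k a (s - r)) • F r =
      (Ioo 0 t).indicator (fun r => (Real.Gamma (1 - a) * Real.Gamma a) • f r) r := by
    intro r
    rw [integral_smul_const]
    by_cases hr : r ∈ Ioo 0 t
    · simp only [F, indicator_of_mem hr]
      congr 1
      rw [← integral_rpow_mul_rpow_eq_Gamma ha ha1 hr.2, intervalIntegral.integral_of_le hr.2.le,
        integral_Ioc_eq_integral_Ioo, ← integral_indicator measurableSet_Ioo]
      congr 1
      ext s
      have hr1 := hr.1
      have hr2 := hr.2
      simp only [k, indicator, mem_Ioo]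
      split_ifs <;> first | rfl | (simp; done) | (exfalso; grind)
    · simp [F, indicator_of_notMem hr]
  have hright : ∀ s, ∫ r, (k (1 - a) (t - s) * k a (s - r)) • F r =
      (Ioo 0 t).indicator (fun s => (t - s) ^ (1 - a - 1) •
        ∫ r in (0 : ℝ)..s, (s - r) ^ (a - 1) • f r) s := by
    intro s
    simp only [mul_smul]
    rw [integral_smul]
    by_cases hs : s ∈ Ioo 0 t
    · have hs1 := hs.1
      have hs2 := hs.2
      rw [indicator_of_mem hs]
      have : t - s ∈ Ioo 0 t := ⟨by linarith, by linarith⟩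
      simp only [k, indicator_of_mem this]
      congr 1
      rw [intervalIntegral.integral_of_le hs1.le,
        integral_Ioc_eq_integral_Ioo, ← integral_indicator measurableSet_Ioo]
      congr 1
      ext r
      simp only [F, indicator, mem_Ioo]
      split_ifs <;> first | rfl | (simp; done) | (exfalso; grind)
    · have : t - s ∉ Ioo 0 t := fun h => hs ⟨by linarith [h.2], by linarith [h.1]⟩
      simp only [k, indicator_of_notMem this, indicator_of_notMem hs, zero_smul]
  simp only [hleft, hright] at hswap
  rw [integral_indicator measurableSet_Ioo, integral_indicator measurableSet_Ioo, integral_smul,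
    ← integral_Ioc_eq_integral_Ioo, ← integral_Ioc_eq_integral_Ioo,
    ← intervalIntegral.integral_of_le ht, ← intervalIntegral.integral_of_le ht] at hswap
  have hG := (Real.Gamma_pos_of_pos ha).ne'
  have hG1 := (Real.Gamma_pos_of_pos (sub_pos.2 ha1)).ne'
  simp only [fracInt]
  simp only [smul_comm _ (Real.Gamma a)⁻¹]
  rw [intervalIntegral.integral_smul, ← hswap, smul_smul, smul_smul]
  field_simp
  simp

/-- With `x = t - s` the weight leaves a factor `e^{-cx}`, and extending the integral to `(0,∞)`
gives `Γ(a) c^{-a}`. The power of `1/c` is what makes the Volterra map contract. -/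
theorem norm_fracInt_le {a : ℝ} (ha : 0 < a) {c : ℝ} (hc : 0 < c) {t : ℝ} (ht : 0 ≤ t)
    {f : ℝ → E} {M : ℝ} (hM : 0 ≤ M) (h : ∀ s ∈ Icc 0 t, ‖f s‖ ≤ M * Real.exp (c * s)) :
    ‖fracInt a f t‖ ≤ M * (1 / c) ^ a * Real.exp (c * t) := by
  have hG := Real.Gamma_pos_of_pos ha
  have hcont : ∀ b, IntervalIntegrable (fun x : ℝ => x ^ (a - 1) * Real.exp (-(c * x)))
      volume 0 b := fun b =>
    (intervalIntegral.intervalIntegrable_rpow' (by linarith)).mul_continuousOn (by fun_prop)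
  have h1 : ‖∫ s in (0 : ℝ)..t, (t - s) ^ (a - 1) • f s‖ ≤
      ∫ s in (0 : ℝ)..t, (t - s) ^ (a - 1) * (M * Real.exp (c * s)) := by
    refine intervalIntegral.norm_integral_le_of_norm_le ht
      (Filter.Eventually.of_forall fun s hs => ?_)
      ((intervalIntegrable_sub_rpow ha t).mul_continuousOn (by fun_prop))
    have h0 : 0 ≤ (t - s) ^ (a - 1) := Real.rpow_nonneg (sub_nonneg.2 hs.2) _
    rw [norm_smul, Real.norm_of_nonneg h0]
    exact mul_le_mul_of_nonneg_left (h s ⟨hs.1.le, hs.2⟩) h0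
  have h2 : ∫ s in (0 : ℝ)..t, (t - s) ^ (a - 1) * (M * Real.exp (c * s)) =
      (M * Real.exp (c * t)) * ∫ x in (0 : ℝ)..t, x ^ (a - 1) * Real.exp (-(c * x)) := by
    have h := intervalIntegral.integral_comp_sub_left (a := 0) (b := t)
      (fun x : ℝ => x ^ (a - 1) * Real.exp (-(c * x))) t
    rw [sub_self, sub_zero] at h
    rw [← h, ← intervalIntegral.integral_const_mul]
    refine intervalIntegral.integral_congr fun s _ => ?_
    have : Real.exp (c * s) = Real.exp (c * t) * Real.exp (-(c * (t - s))) := by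
      rw [← Real.exp_add]; ring_nf
    simp only [this]
    ring
  have h3 : ∫ x in (0 : ℝ)..t, x ^ (a - 1) * Real.exp (-(c * x)) ≤
      (1 / c) ^ a * Real.Gamma a := by
    have hval := Real.integral_rpow_mul_exp_neg_mul_Ioi ha hc
    have hpos : 0 < (1 / c) ^ a * Real.Gamma a := mul_pos (Real.rpow_pos_of_pos (by positivity) _) hG
    rw [intervalIntegral.integral_of_le ht, ← hval]
    refine setIntegral_mono_set ?_ ?_ Ioc_subset_Ioi_self.eventuallyLE
    -- A divergent integral would have the default value `0`, but the gamma integral is positive.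
    · by_contra hn
      rw [integral_undef hn] at hval
      exact hpos.ne hval
    · filter_upwards [ae_restrict_mem measurableSet_Ioi] with x hx
      exact mul_nonneg (Real.rpow_nonneg (le_of_lt hx) _) (Real.exp_pos _).le
  rw [fracInt, norm_smul, norm_inv, Real.norm_of_nonneg hG.le]
  calc (Real.Gamma a)⁻¹ * ‖∫ s in (0 : ℝ)..t, (t - s) ^ (a - 1) • f s‖
      ≤ (Real.Gamma a)⁻¹ * ((M * Real.exp (c * t)) * ((1 / c) ^ a * Real.Gamma a)) := by
        gcongr
        exact h1.trans (h2.le.trans (by gcongr))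
    _ = _ := by field_simp

end FracInt

/-! ### Volterra equations with Lipschitz right-hand side -/

section Volterra

variable {E : Type*} [NormedAddCommGroup E] [NormedSpace ℝ E]

theorem exists_exp_rate {a : ℝ} (ha : 0 < a) {L : ℝ} (hL : 0 ≤ L) :
    ∃ c : ℝ, 0 < c ∧ L * (1 / c) ^ a ≤ 1 / 2 := by
  refine ⟨(2 * (L + 1)) ^ (1 / a), by positivity, ?_⟩
  have h : (1 / (2 * (L + 1)) ^ (1 / a)) ^ a = 1 / (2 * (L + 1)) := by
    rw [Real.div_rpow zero_le_one (by positivity), Real.one_rpow, ← Real.rpow_mul (by positivity),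
      one_div_mul_cancel ha.ne', Real.rpow_one]
  rw [h, mul_one_div, div_le_div_iff₀ (by positivity) two_pos]
  linarith

theorem norm_fracInt_sub_fracInt_le {a : ℝ} (ha : 0 < a) {T L c : ℝ} (hL : 0 ≤ L)
    (hc : 0 < c) (hLc : L * (1 / c) ^ a ≤ 1 / 2) {F : ℝ → E → E}
    (hLip : ∀ t ∈ Icc 0 T, ∀ x y, ‖F t x - F t y‖ ≤ L * ‖x - y‖)
    (hF : ∀ y : ℝ → E, ContinuousOn y (Icc 0 T) → ContinuousOn (fun t => F t (y t)) (Icc 0 T))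
    {x y : ℝ → E} (hx : ContinuousOn x (Icc 0 T)) (hy : ContinuousOn y (Icc 0 T)) {M : ℝ}
    (hM : 0 ≤ M) (h : ∀ s ∈ Icc 0 T, ‖x s - y s‖ ≤ M * Real.exp (c * s)) {t : ℝ}
    (ht : t ∈ Icc 0 T) :
    ‖fracInt a (fun s => F s (x s)) t - fracInt a (fun s => F s (y s)) t‖ ≤
      1 / 2 * M * Real.exp (c * t) := by
  have hsub : Icc 0 t ⊆ Icc 0 T := Icc_subset_Icc_right ht.2
  rw [← fracInt_sub ha ht.1 ((hF x hx).mono hsub) ((hF y hy).mono hsub)]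
  refine (norm_fracInt_le ha hc ht.1 (mul_nonneg hL hM) fun s hs => ?_).trans ?_
  · calc _ ≤ L * ‖x s - y s‖ := hLip s (hsub hs) _ _
      _ ≤ L * (M * Real.exp (c * s)) := by gcongr; exact h s (hsub hs)
      _ = _ := by ring
  · rw [mul_right_comm L M]
    gcongr

theorem exists_fracInt_fixedPoint [CompleteSpace E] {a : ℝ} (ha : 0 < a) {T L : ℝ} (hT : 0 ≤ T)
    (hL : 0 ≤ L) {F : ℝ → E → E}
    (hLip : ∀ t ∈ Icc 0 T, ∀ x y, ‖F t x - F t y‖ ≤ L * ‖x - y‖)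
    (hF : ∀ y : ℝ → E, ContinuousOn y (Icc 0 T) → ContinuousOn (fun t => F t (y t)) (Icc 0 T))
    (y₀ : E) :
    ∃ y : ℝ → E, ContinuousOn y (Icc 0 T) ∧
      ∀ t ∈ Icc 0 T, y t = y₀ + fracInt a (fun s => F s (y s)) t := by
  obtain ⟨c, hc, hLc⟩ := exists_exp_rate ha hL
  -- The unknown is `z s = e^{-cs} y s`, so the usual sup norm of `z` is the weighted norm of `y`.
  let ext : C(Icc (0 : ℝ) T, E) → ℝ → E := fun z s => Real.exp (c * s) • IccExtend hT z s
  have hext : ∀ z, ContinuousOn (ext z) (Icc 0 T) := fun z =>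
    ((Real.continuous_exp.comp (continuous_const.mul continuous_id)).smul
      z.continuous.Icc_extend').continuousOn
  have hJ : ∀ z, ContinuousOn (fracInt a (fun s => F s (ext z s))) (Icc 0 T) := fun z =>
    continuousOn_fracInt ha (hF _ (hext z))
  let Φ : C(Icc (0 : ℝ) T, E) → C(Icc (0 : ℝ) T, E) := fun z =>
    ⟨fun t => Real.exp (-(c * t)) • (y₀ + fracInt a (fun s => F s (ext z s)) t), by
      refine Continuous.smul (by fun_prop) (continuous_const.add ?_)
      exact continuousOn_iff_continuous_domRestrict.1 (hJ z)⟩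
  have hΦ : ContractingWith (1 / 2) Φ := by
    refine ⟨by norm_num, LipschitzWith.of_dist_le_mul fun z w => ?_⟩
    refine (ContinuousMap.dist_le (by positivity)).2 fun t => ?_
    have h := norm_fracInt_sub_fracInt_le ha hL hc hLc hLip hF (hext z) (hext w)
      (dist_nonneg (x := z) (y := w)) (fun s hs => ?_) t.2
    · simp only [Φ, ContinuousMap.coe_mk, dist_eq_norm (Real.exp _ • _), ← smul_sub, norm_smul,
        Real.norm_eq_abs, Real.abs_exp, add_sub_add_left_eq_sub]
      calc _ ≤ Real.exp (-(c * t)) * (1 / 2 * dist z w * Real.exp (c * t)) := by gcongr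
        _ = Real.exp (-(c * t)) * Real.exp (c * t) * (1 / 2 * dist z w) := by ring
        _ = _ := by rw [← Real.exp_add]; simp
    · simp only [ext, ← smul_sub, norm_smul, Real.norm_eq_abs, Real.abs_exp]
      rw [mul_comm, IccExtend_of_mem _ _ hs, IccExtend_of_mem _ _ hs, ← dist_eq_norm]
      gcongr
      exact ContinuousMap.dist_apply_le_dist _
  obtain ⟨z, hz⟩ : ∃ z, Φ z = z := ⟨_, hΦ.fixedPoint_isFixedPt⟩
  refine ⟨ext z, hext z, fun t ht => ?_⟩
  have h := DFunLike.congr_fun hz ⟨t, ht⟩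
  simp only [Φ, ContinuousMap.coe_mk] at h
  simp only [ext, IccExtend_of_mem _ _ ht]
  rw [← h, smul_smul, ← Real.exp_add]
  simp [ext]

theorem eqOn_of_fracInt_fixedPoint {a : ℝ} (ha : 0 < a) {T L : ℝ} (hT : 0 ≤ T)
    (hL : 0 ≤ L) {F : ℝ → E → E}
    (hLip : ∀ t ∈ Icc 0 T, ∀ x y, ‖F t x - F t y‖ ≤ L * ‖x - y‖)
    (hF : ∀ y : ℝ → E, ContinuousOn y (Icc 0 T) → ContinuousOn (fun t => F t (y t)) (Icc 0 T))
    {y₀ : E} {x y : ℝ → E} (hx : ContinuousOn x (Icc 0 T)) (hy : ContinuousOn y (Icc 0 T))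
    (hxe : ∀ t ∈ Icc 0 T, x t = y₀ + fracInt a (fun s => F s (x s)) t)
    (hye : ∀ t ∈ Icc 0 T, y t = y₀ + fracInt a (fun s => F s (y s)) t) :
    EqOn x y (Icc 0 T) := by
  obtain ⟨c, hc, hLc⟩ := exists_exp_rate ha hL
  have hcont : ContinuousOn (fun s => Real.exp (-(c * s)) * ‖x s - y s‖) (Icc 0 T) :=
    ContinuousOn.mul (by fun_prop) (hx.sub hy).norm
  obtain ⟨m, hm, hmax⟩ := isCompact_Icc.exists_isMaxOn (nonempty_Icc.2 hT) hcont
  -- `M` is the weighted distance of the two solutions, attained at `m`; the contraction estimate at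
  -- `m` forces `M ≤ M / 2`.
  set M := Real.exp (-(c * m)) * ‖x m - y m‖ with hMdef
  have hM : 0 ≤ M := by positivity
  have hb : ∀ s ∈ Icc 0 T, ‖x s - y s‖ ≤ M * Real.exp (c * s) := by
    intro s hs
    have h : Real.exp (-(c * s)) * ‖x s - y s‖ ≤ M := hmax hs
    rw [Real.exp_neg, inv_mul_le_iff₀ (Real.exp_pos _)] at h
    linarith
  have h := norm_fracInt_sub_fracInt_le ha hL hc hLc hLip hF hx hy hM hb hm
  have h2 : x m - y m =
      fracInt a (fun s => F s (x s)) m - fracInt a (fun s => F s (y s)) m := by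
    rw [hxe m hm, hye m hm, add_sub_add_left_eq_sub]
  rw [← h2] at h
  have h3 : M ≤ 1 / 2 * M := by
    rw [hMdef, Real.exp_neg, inv_mul_le_iff₀ (Real.exp_pos _), ← Real.exp_neg]
    linarith
  have hM0 : M = 0 := by linarith
  intro s hs
  have := hb s hs
  rw [hM0, zero_mul] at this
  exact sub_eq_zero.1 (norm_le_zero_iff.1 this)

end Volterra

/-! ### Caputo derivatives and their inversion -/

section Caputo

variable {E E' : Type*} [NormedAddCommGroup E] [NormedSpace ℝ E] [NormedAddCommGroup E']
  [NormedSpace ℝ E']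

theorem caputoIntegral_eq_fracInt (ρ : ℝ) (w : ℝ → E) (t : ℝ) :
    caputoIntegral ρ w t = fracInt (1 - ρ) (fun s => w s - w 0) t := by
  simp only [caputoIntegral, fracInt, sub_sub_cancel_left]

theorem hasDerivWithinAt_integral_Icc [CompleteSpace E] {T : ℝ} {f : ℝ → E}
    (hf : ContinuousOn f (Icc 0 T)) {t : ℝ} (ht : t ∈ Icc 0 T) :
    HasDerivWithinAt (fun u => ∫ s in (0 : ℝ)..u, f s) (f t) (Icc 0 T) t := by
  have : Fact (t ∈ Icc 0 T) := ⟨ht⟩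
  refine intervalIntegral.integral_hasDerivWithinAt_right ?_
    (hf.stronglyMeasurableAtFilter_nhdsWithin measurableSet_Icc t) (hf t ht)
  refine ContinuousOn.intervalIntegrable ?_
  rw [uIcc_of_le ht.1]
  exact hf.mono (Icc_subset_Icc_right ht.2)

theorem HasCaputoDerivOn.congr {ρ T : ℝ} {w w' d d' : ℝ → E} (h : HasCaputoDerivOn ρ T w d)
    (hw : EqOn w' w (Icc 0 T)) (hd : EqOn d' d (Ioc 0 T)) : HasCaputoDerivOn ρ T w' d' := by
  have hw0 : ∀ t ∈ Icc 0 T, EqOn (fun s => (t - s) ^ (-ρ) • (w' s - w' 0))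
      (fun s => (t - s) ^ (-ρ) • (w s - w 0)) (Icc 0 t) := fun t ht s hs => by
    simp only [hw ⟨hs.1, hs.2.trans ht.2⟩, hw ⟨le_rfl, ht.1.trans ht.2⟩]
  have hI : EqOn (caputoIntegral ρ w') (caputoIntegral ρ w) (Icc 0 T) := fun t ht => by
    unfold caputoIntegral
    congr 1
    exact intervalIntegral.integral_congr (by rw [uIcc_of_le ht.1]; exact hw0 t ht)
  refine ⟨fun t ht => (h.1 t ht).congr ?_, fun t ht => ?_⟩
  · rw [uIoc_of_le ht.1.le]
    exact fun s hs => ((hw0 t ⟨ht.1.le, ht.2⟩) ⟨hs.1.le, hs.2⟩).symm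
  · rw [hd ht]
    exact (h.2 t ht).congr hI (hI ⟨ht.1.le, ht.2⟩)

theorem HasCaputoDerivOn.clm_comp [CompleteSpace E] [CompleteSpace E'] {ρ T : ℝ} {w d : ℝ → E}
    (h : HasCaputoDerivOn ρ T w d) (B : E →L[ℝ] E') :
    HasCaputoDerivOn ρ T (fun t => B (w t)) (fun t => B (d t)) := by
  have hB : ∀ t, (fun s => (t - s) ^ (-ρ) • (B (w s) - B (w 0))) =
      fun s => B ((t - s) ^ (-ρ) • (w s - w 0)) := fun t => by simp
  have hI : EqOn (caputoIntegral ρ fun t => B (w t)) (fun t => B (caputoIntegral ρ w t))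
      (Icc 0 T) := fun t ht => by
    rcases ht.1.eq_or_lt with rfl | h0
    · simp [caputoIntegral]
    · simp only [caputoIntegral, map_smul]
      rw [hB, B.intervalIntegral_comp_comm (h.1 t ⟨h0, ht.2⟩)]
  refine ⟨fun t ht => ?_, fun t ht => ?_⟩
  · rw [hB]
    exact ⟨B.integrable_comp (h.1 t ht).1, B.integrable_comp (h.1 t ht).2⟩
  · exact (B.hasFDerivAt.comp_hasDerivWithinAt t (h.2 t ht)).congr hI (hI ⟨ht.1.le, ht.2⟩)

theorem hasCaputoDerivOn_of_eq_fracInt [CompleteSpace E] {ρ T : ℝ} (hρ0 : 0 < ρ) (hρ1 : ρ < 1)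
    {y f : ℝ → E} {y₀ : E} (hf : ContinuousOn f (Icc 0 T))
    (hy : ∀ t ∈ Icc 0 T, y t = y₀ + fracInt ρ f t) : HasCaputoDerivOn ρ T y f := by
  have hsub : ∀ t ∈ Icc 0 T, EqOn (fun s => y s - y 0) (fracInt ρ f) (Icc 0 t) :=
    fun t ht s hs => by
      simp [hy s ⟨hs.1, hs.2.trans ht.2⟩, hy 0 ⟨le_rfl, ht.1.trans ht.2⟩]
  have hI : EqOn (caputoIntegral ρ y) (fun t => ∫ s in (0 : ℝ)..t, f s) (Icc 0 T) :=
    fun t ht => by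
      rw [caputoIntegral_eq_fracInt, fracInt_congr ht.1 (hsub t ht)]
      exact fracInt_fracInt hρ0 hρ1 ht.1 (hf.mono (Icc_subset_Icc_right ht.2))
  refine ⟨fun t ht => ?_, fun t ht => ?_⟩
  · have ht' : t ∈ Icc 0 T := ⟨ht.1.le, ht.2⟩
    have h := intervalIntegrable_sub_rpow_smul (sub_pos.2 hρ1) ht.1.le
      ((((continuousOn_fracInt hρ0 hf)).mono (Icc_subset_Icc_right ht.2)).congr (hsub t ht'))
    simpa only [sub_sub_cancel_left] using h
  · have ht' : t ∈ Icc 0 T := ⟨ht.1.le, ht.2⟩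
    exact (hasDerivWithinAt_integral_Icc hf ht').congr hI (hI ht')

/-- For the defect `z = w - w 0 - I^ρ f`, the integral `I^{1-ρ} z` vanishes, since `I^{1-ρ} (w - w
0)` and `∫ f` have the same derivative and both start at `0`. Applying `I^ρ` gives `∫ z = 0`, and
differentiating gives `z = 0`. -/
theorem HasCaputoDerivOn.eq_add_fracInt [CompleteSpace E] {ρ T : ℝ} (hρ0 : 0 < ρ) (hρ1 : ρ < 1)
    (hT : 0 < T) {w f : ℝ → E} (h : HasCaputoDerivOn ρ T w f) (hw : ContinuousOn w (Icc 0 T))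
    (hf : ContinuousOn f (Icc 0 T)) : ∀ t ∈ Icc 0 T, w t = w 0 + fracInt ρ f t := by
  have hρ1' : 0 < 1 - ρ := sub_pos.2 hρ1
  have hw0 : ContinuousOn (fun s => w s - w 0) (Icc 0 T) := hw.sub continuousOn_const
  have hJ := continuousOn_fracInt hρ0 hf
  set z : ℝ → E := fun s => (w s - w 0) - fracInt ρ f s with hz
  have hzc : ContinuousOn z (Icc 0 T) := hw0.sub hJ
  have hcap : ContinuousOn (caputoIntegral ρ w) (Icc 0 T) :=
    (continuousOn_fracInt hρ1' hw0).congr fun t _ => caputoIntegral_eq_fracInt ρ w t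
  have hFz : ∀ t ∈ Icc 0 T, fracInt (1 - ρ) z t = 0 := by
    intro t ht
    have hs : Icc 0 t ⊆ Icc 0 T := Icc_subset_Icc_right ht.2
    rw [hz, fracInt_sub hρ1' ht.1 (hw0.mono hs) (hJ.mono hs),
      fracInt_fracInt hρ0 hρ1 ht.1 (hf.mono hs), ← caputoIntegral_eq_fracInt,
      intervalIntegral.integral_eq_sub_of_hasDerivAt_of_le ht.1 (hcap.mono hs)
        (fun x hx => (h.2 x ⟨hx.1, hx.2.le.trans ht.2⟩).hasDerivAt
          (Icc_mem_nhds hx.1 (hx.2.trans_le ht.2)))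
        (ContinuousOn.intervalIntegrable (by rw [uIcc_of_le ht.1]; exact hf.mono hs))]
    simp [caputoIntegral]
  have hIz : EqOn (fun t => ∫ s in (0 : ℝ)..t, z s) (fun _ => 0) (Icc 0 T) := by
    intro t ht
    have hs : Icc 0 t ⊆ Icc 0 T := Icc_subset_Icc_right ht.2
    simp only
    rw [← fracInt_fracInt hρ1' (by linarith) ht.1 (hzc.mono hs),
      fracInt_congr ht.1 (g := fun _ => 0) fun s hs' => hFz s (hs hs')]
    simp [fracInt]
  intro t ht
  have h1 := hasDerivWithinAt_integral_Icc hzc ht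
  have h2 : HasDerivWithinAt (fun t => ∫ s in (0 : ℝ)..t, z s) 0 (Icc 0 T) t :=
    (hasDerivWithinAt_const t _ (0 : E)).congr hIz (hIz ht)
  have h3 : z t = 0 := (uniqueDiffOn_Icc hT t ht).eq_deriv _ h1 h2
  rw [hz] at h3
  rw [← sub_eq_zero, ← sub_sub]
  exact h3

end Caputo

/-! ### The inverse of `A` and of `A⁻¹ + μ` -/

section Operator

variable {𝕜 H : Type*} [RCLike 𝕜] [NormedAddCommGroup H] [InnerProductSpace 𝕜 H]

theorem opVal_of_mem {A : H →ₗ.[𝕜] H} {x : H} (hx : x ∈ A.domain) : opVal A x = A ⟨x, hx⟩ :=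
  dif_pos hx

/-- For a positive operator `A` with bounded inverse `K`, the operator `K + μ` is invertible. -/
theorem exists_inverse_and_resolvent [NormedSpace ℝ H] [IsScalarTower ℝ 𝕜 H] [CompleteSpace H]
    {A : H →ₗ.[𝕜] H} (hA_pos : IsPositiveOp A) (hA_inv : HasCompactInverse A) {μ : ℝ}
    (hμ : 0 < μ) :
    ∃ K S : H →L[𝕜] H, (∀ y, K y ∈ A.domain) ∧ (∀ y, opVal A (K y) = y) ∧
      (∀ x ∈ A.domain, K (opVal A x) = x) ∧ (∀ y, K (S y) + μ • S y = y) ∧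
      (∀ y, S (K y) + μ • S y = y) := by
  obtain ⟨K, -, hAK, hKA⟩ := hA_inv
  have hpos : ∀ y, 0 ≤ RCLike.re (inner 𝕜 (K y) y) := fun y => by
    obtain ⟨h, hy⟩ := hAK y
    have := hA_pos ⟨K y, h⟩
    rwa [hy, inner_re_symm] at this
  -- Coercivity: `Re ((K + μ) x, x) ≥ μ ‖x‖²`.
  have hU : IsUnit (K + (μ : 𝕜) • (1 : H →L[𝕜] H)) := by
    refine ContinuousLinearMap.isUnit_of_forall_le_norm_inner_map _ (c := ⟨μ, hμ.le⟩) hμ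
      fun x => ?_
    refine le_trans ?_ (RCLike.re_le_norm _)
    simp only [add_apply, smul_apply, one_apply_eq_self, inner_add_left, inner_smul_left, map_add,
      RCLike.conj_ofReal,
      RCLike.re_ofReal_mul, inner_self_eq_norm_sq]
    have := hpos x
    change ‖x‖ ^ 2 * μ ≤ _
    linarith
  obtain ⟨⟨V, S, hVS, hSV⟩, rfl : V = _⟩ := hU
  refine ⟨K, S, fun y => (hAK y).1, fun y => ?_, fun x hx => ?_, fun y => ?_, fun y => ?_⟩
  · obtain ⟨h, hy⟩ := hAK y
    rw [opVal_of_mem h, hy]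
  · rw [opVal_of_mem hx]
    exact hKA ⟨x, hx⟩
  · rw [RCLike.real_smul_eq_coe_smul (K := 𝕜)]
    exact DFunLike.congr_fun hVS y
  · rw [RCLike.real_smul_eq_coe_smul (K := 𝕜), ← map_smul, ← map_add]
    exact DFunLike.congr_fun hSV y

end Operator

/-! ### Existence and uniqueness for the forward problem -/

section ForwardProblem

variable {𝕜 H : Type*} [RCLike 𝕜] [NormedAddCommGroup H] [InnerProductSpace 𝕜 H]
  [NormedSpace ℝ H]

theorem continuousOn_affine_rhs {T : ℝ} {σ : ℝ → ℝ}
    (hσ : ContinuousOn σ (Icc 0 T)) {r : ℝ → 𝕜} (hr : ContinuousOn r (Icc 0 T)) (g : H)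
    (B S : H →L[𝕜] H) {y : ℝ → H} (hy : ContinuousOn y (Icc 0 T)) :
    ContinuousOn (fun t => B (r t • g) - σ t • S (y t)) (Icc 0 T) :=
  (B.continuous.comp_continuousOn (hr.smul continuousOn_const)).sub
    (hσ.smul (S.continuous.comp_continuousOn hy))

theorem norm_affine_rhs_sub_le {T M : ℝ} {σ : ℝ → ℝ} (hM : ∀ t ∈ Icc 0 T, ‖σ t‖ ≤ M)
    (S : H →L[𝕜] H) (b : ℝ → H) :
    ∀ t ∈ Icc 0 T, ∀ x y, ‖(b t - σ t • S x) - (b t - σ t • S y)‖ ≤ M * ‖S‖ * ‖x - y‖ := by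
  intro t ht x y
  rw [sub_sub_sub_cancel_left, ← smul_sub, ← map_sub, norm_smul, mul_assoc, norm_sub_rev x y]
  gcongr
  · exact (norm_nonneg _).trans (hM t ht)
  · exact hM t ht
  · exact S.le_opNorm _

variable [IsScalarTower ℝ 𝕜 H] [CompleteSpace H]

theorem exists_isForwardSolution
    {A : H →ₗ.[𝕜] H} (hA_pos : IsPositiveOp A)
    (hA_inv : HasCompactInverse A) {ρ μ T : ℝ} (hρ0 : 0 < ρ) (hρ1 : ρ < 1) (hμ : 0 < μ) (hT : 0 < T)
    {σ : ℝ → ℝ} (hσ : ContinuousOn σ (Icc 0 T)) {r : ℝ → 𝕜} (hr : ContinuousOn r (Icc 0 T))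
    {g φ : H} (hφ : φ ∈ A.domain) :
    ∃ u : ℝ → H, IsForwardSolution A ρ μ T σ r g φ u := by
  obtain ⟨K, S, hK, hAK, hKA, hKS, -⟩ := exists_inverse_and_resolvent hA_pos hA_inv hμ
  obtain ⟨M, hM⟩ := isCompact_Icc.exists_bound_of_continuousOn hσ
  have hM0 : 0 ≤ M := (norm_nonneg _).trans (hM 0 ⟨le_rfl, hT.le⟩)
  obtain ⟨y, hyc, hy⟩ := exists_fracInt_fixedPoint hρ0 hT.le
    (F := fun t y => S (r t • g) - σ t • S y) (mul_nonneg hM0 (norm_nonneg S))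
    (norm_affine_rhs_sub_le hM S _)
    (fun y hy => continuousOn_affine_rhs hσ hr g S S hy) (opVal A φ)
  have hfc := continuousOn_affine_rhs hσ hr g S S hyc
  have hcap := hasCaputoDerivOn_of_eq_fracInt hρ0 hρ1 hfc hy
  have hfc' := hfc.mono Ioc_subset_Icc_self
  -- `u + μ A u = (K + μ) y`, and `K + μ` undoes the `S` in the equation for `y`.
  have hsum := hcap.clm_comp (K.restrictScalars ℝ + μ • ContinuousLinearMap.id ℝ H)
  refine ⟨fun t => K (y t), ?_, fun t _ => hK _, ?_, ?_, ?_, ?_, ?_⟩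
  · exact K.continuous.comp_continuousOn hyc
  · simp only [hAK]
    exact hyc.mono Ioc_subset_Icc_self
  · exact ⟨_, K.continuous.comp_continuousOn hfc', hcap.clm_comp (K.restrictScalars ℝ)⟩
  · simp only [hAK]
    exact ⟨_, hfc', hcap⟩
  · simp only [hAK]
    refine ⟨fun t => r t • g - σ t • y t, hsum.congr (fun t _ => by simp) fun t _ => ?_,
      fun t _ => sub_add_cancel _ _⟩
    have hS : S (r t • g) - σ t • S (y t) = S (r t • g - σ t • y t) := by
      rw [map_sub, S.map_smul_of_tower (σ t)]
    simp only [hS]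
    simpa using (hKS (r t • g - σ t • y t)).symm
  · rw [hy 0 ⟨le_rfl, hT.le⟩, fracInt_zero_right, add_zero, hKA φ hφ]

theorem IsForwardSolution.eqOn
    {A : H →ₗ.[𝕜] H} (hA_pos : IsPositiveOp A)
    (hA_inv : HasCompactInverse A) {ρ μ T : ℝ} (hρ0 : 0 < ρ) (hρ1 : ρ < 1) (hμ : 0 < μ) (hT : 0 < T)
    {σ : ℝ → ℝ} (hσ : ContinuousOn σ (Icc 0 T)) {r : ℝ → 𝕜} (hr : ContinuousOn r (Icc 0 T))
    {g φ : H}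
    {u v : ℝ → H} (hu : IsForwardSolution A ρ μ T σ r g φ u)
    (hv : IsForwardSolution A ρ μ T σ r g φ v) : EqOn u v (Icc 0 T) := by
  obtain ⟨K, S, hK, hAK, hKA, hKS, hSK⟩ := exists_inverse_and_resolvent hA_pos hA_inv hμ
  obtain ⟨M, hM⟩ := isCompact_Icc.exists_bound_of_continuousOn hσ
  have hM0 : 0 ≤ M := (norm_nonneg _).trans (hM 0 ⟨le_rfl, hT.le⟩)
  -- Both sides equal `y - μ S y`.
  have hcomm : ∀ y, K (S y) = S (K y) := fun y =>
    add_right_cancel ((hKS y).trans (hSK y).symm)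
  have key : ∀ w, IsForwardSolution A ρ μ T σ r g φ w → ∀ t ∈ Icc 0 T,
      w t = φ + fracInt ρ (fun s => (K ∘L S) (r s • g) - σ s • S (w s)) t := by
    intro w hw
    obtain ⟨d, hd, heq⟩ := hw.equation
    have hd' := hd.clm_comp ((K ∘L S).restrictScalars ℝ)
    rw [← hw.initial]
    refine (hd'.congr (fun t ht => ?_) fun t ht => ?_).eq_add_fracInt hρ0 hρ1 hT hw.continuousOn
      (continuousOn_affine_rhs hσ hr g (K ∘L S) S hw.continuousOn)
    -- With `y = A w` and `w = K y`, `K S (w + μ A w) = K (S (K y) + μ S y) = K y = w`.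
    · have hwt := hKA (w t) (hw.mem_domain t ht)
      set y := opVal A (w t)
      rw [← hwt]
      simp only [ContinuousLinearMap.coe_restrictScalars', ContinuousLinearMap.comp_apply,
        map_add, S.map_smul_of_tower μ]
      rw [← map_add, hSK]
    -- The unbounded term disappears: `K S A w = S K A w = S w`.
    · have hwt := hKA (w t) (hw.mem_domain t ⟨ht.1.le, ht.2⟩)
      have hdt : d t = r t • g - σ t • opVal A (w t) := eq_sub_of_add_eq (heq t ht)
      simp only [ContinuousLinearMap.coe_restrictScalars', hdt, map_sub]
      rw [(K ∘L S).map_smul_of_tower (σ t), ContinuousLinearMap.comp_apply (x := opVal A (w t)),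
        hcomm, hwt]
  exact eqOn_of_fracInt_fixedPoint hρ0 hT.le
    (F := fun t y => (K ∘L S) (r t • g) - σ t • S y) (mul_nonneg hM0 (norm_nonneg S))
    (norm_affine_rhs_sub_le hM S _) (fun y hy => continuousOn_affine_rhs hσ hr g (K ∘L S) S hy)
    hu.continuousOn hv.continuousOn (key u hu) (key v hv)

end ForwardProblem

end

theorem theorem4p3 {𝕜 H : Type*} [RCLike 𝕜] [NormedAddCommGroup H] [InnerProductSpace 𝕜 H]
    [NormedSpace ℝ H] [IsScalarTower ℝ 𝕜 H] [CompleteSpace H]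
    [TopologicalSpace.SeparableSpace H]
    (A : H →ₗ.[𝕜] H) (hA_sa : IsSelfAdjoint A) (hA_pos : IsPositiveOp A)
    (hA_inv : HasCompactInverse A)
    (ρ μ T : ℝ) (hρ0 : 0 < ρ) (hρ1 : ρ < 1) (hμ : 0 < μ) (hT : 0 < T)
    (σ : ℝ → ℝ) (hσ : ContinuousOn σ (Icc 0 T))
    (m_σ : ℝ) (hm_σ : 0 < m_σ) (hσ_lower : ∀ t ∈ Icc 0 T, m_σ ≤ σ t)
    (r : ℝ → 𝕜) (hr : ContinuousOn r (Icc 0 T))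
    (g φ : H) (hφ : φ ∈ A.domain) :
    (∃ u : ℝ → H, IsForwardSolution A ρ μ T σ r g φ u) ∧
    (∀ u v : ℝ → H, IsForwardSolution A ρ μ T σ r g φ u →
      IsForwardSolution A ρ μ T σ r g φ v → EqOn u v (Icc 0 T)) := by
  exact ⟨exists_isForwardSolution hA_pos hA_inv hρ0 hρ1 hμ hT hσ hr hφ, fun u v hu hv =>
    hu.eqOn hA_pos hA_inv hρ0 hρ1 hμ hT hσ hr hv⟩
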